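/- Let $A$ and $B$ be $C^*$-algebras with $A$ unital ($B$ need not be unital), let $\varepsilon\ge 0$, and let $\varphi\colon A\to B$ be a bounded linear operator which is an $\varepsilon$-order zero map, i.e. $\|\varphi(x)\varphi(y)\|\le\varepsilon\|x\|\,\|y\|$ for all positive $x,y\in A$ with $x\perp y$ (that is, $xy=yx=x^*y=xy^*=0$). Put $h=\varphi(1_A)$ and $\|\varphi\|_+=\sup\{\|\varphi(x)\|\colon x\in A,\ x\ge 0,\ \|x\|\le 1\}$. For a complex polynomial $P$ the element $P(h)$ is taken in $B$ if $B$ is unital, and in the unitization of $B$ (with its $C^*$-norm) otherwise; equivalently, in the multiplier algebra of $B$. Let $\tau$ denote the left shift on coefficients, $\tau P(z)=z^{-1}(P(z)-P(0))$, and define $\Theta_N(P)$ for complex polynomials $P$ of degree $N\ge 1$ recursively by $$\Theta_1(az+b)=8|a|\varepsilon,\qquad \Theta_N(P)=8\|\varphi\|_+\,\Theta_{N-1}(\tau P)+8\|\tau P(h)\|\,\varepsilon\quad (N\ge 2).$$ Then for every complex polynomial $P$ of degree $N>0$ and every positive $x\in A$, $$\|P(h)\varphi(x)-\varphi(x)P(h)\|\le\Theta_N(P)\,\|x\|.$$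 -/

import Mathlib

open scoped MultiplierAlgebra Polynomial

noncomputable section

namespace EpsOrderZero

/-- Orthogonality in a C*-algebra: `xy = yx = x*y = xy* = 0`. -/
def Orthogonal {A : Type*} [NonUnitalCStarAlgebra A] (x y : A) : Prop :=
  x * y = 0 ∧ y * x = 0 ∧ star x * y = 0 ∧ x * star y = 0

/-- `φ` is an `ε`-order zero map, where `ε ≥ 0`. -/
def IsEpsOrderZero {A B : Type*} [NonUnitalCStarAlgebra A] [PartialOrder A] [StarOrderedRing A]
    [NonUnitalCStarAlgebra B] (ε : ℝ) (φ : A →L[ℂ] B) : Prop :=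
  0 ≤ ε ∧ ∀ x y : A, 0 ≤ x → 0 ≤ y → Orthogonal x y → ‖φ x * φ y‖ ≤ ε * ‖x‖ * ‖y‖

/-- `‖φ‖₊ = sup {‖φ x‖ : x ≥ 0, ‖x‖ ≤ 1}`; the set is nonempty and bounded above by `‖φ‖`. -/
def normPos {A B : Type*} [NonUnitalCStarAlgebra A] [PartialOrder A] [StarOrderedRing A]
    [NonUnitalCStarAlgebra B] (φ : A →L[ℂ] B) : ℝ :=
  sSup {r : ℝ | ∃ x : A, 0 ≤ x ∧ ‖x‖ ≤ 1 ∧ r = ‖φ x‖}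

/-- The value `P(b)`. As `B` need not have a unit, it is taken in the multiplier algebra of `B`,
which is `B` itself if `B` is unital (see `polyAt_eq_coe`, `norm_polyAt`), and contains the
unitization of `B` isometrically if it is not. -/
def polyAt {B : Type*} [NonUnitalCStarAlgebra B] (P : ℂ[X]) (b : B) : 𝓜(ℂ, B) :=
  Polynomial.aeval (b : 𝓜(ℂ, B)) P

/-- The numbers `Θ_N(P)` attached to `φ` and `ε`; the left shift `τ` of the coefficients is
`Polynomial.divX`. The value at `N = 0` is a placeholder. -/
def theta {A B : Type*} [CStarAlgebra A] [PartialOrder A] [StarOrderedRing A]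
    [NonUnitalCStarAlgebra B] (φ : A →L[ℂ] B) (ε : ℝ) : ℕ → ℂ[X] → ℝ
  | 0, _ => 0
  | 1, P => 8 * ‖P.coeff 1‖ * ε
  | N + 2, P => 8 * normPos φ * theta φ ε (N + 1) P.divX + 8 * ‖polyAt P.divX (φ 1)‖ * ε

/-- For unital `B`, the value `P(b)` is the usual one. -/
theorem polyAt_eq_coe {B : Type*} [CStarAlgebra B] (P : ℂ[X]) (b : B) :
    polyAt P b = ((Polynomial.aeval b P : B) : 𝓜(ℂ, B)) := by
  have h1 : ((1 : B) : 𝓜(ℂ, B)) = 1 := by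
    ext x <;> simp
  have hm : ∀ x y : B, ((x * y : B) : 𝓜(ℂ, B)) = x * y := fun x y =>
    map_mul (DoubleCentralizer.coeHom (𝕜 := ℂ) (A := B)) x y
  have ha : ∀ x y : B, ((x + y : B) : 𝓜(ℂ, B)) = x + y := fun x y =>
    map_add (DoubleCentralizer.coeHom (𝕜 := ℂ) (A := B)) x y
  have hs : ∀ (c : ℂ) (x : B), ((c • x : B) : 𝓜(ℂ, B)) = c • (x : 𝓜(ℂ, B)) := fun c x =>
    map_smul (DoubleCentralizer.coeHom (𝕜 := ℂ) (A := B)) c x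
  unfold polyAt
  induction P using Polynomial.induction_on with
  | C a => simp [Algebra.algebraMap_eq_smul_one, hs, h1]
  | add p q hp hq => simp [ha, hp, hq]
  | monomial n a h =>
    rw [pow_succ, ← mul_assoc, map_mul, h, Polynomial.aeval_X, ← hm]
    simp only [map_mul, Polynomial.aeval_X]

theorem norm_polyAt {B : Type*} [CStarAlgebra B] (P : ℂ[X]) (b : B) :
    ‖polyAt P b‖ = ‖(Polynomial.aeval b P : B)‖ := by
  rw [polyAt_eq_coe, ← DoubleCentralizer.norm_fst, DoubleCentralizer.coe_fst,
    ContinuousLinearMap.opNorm_mul_apply]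

end EpsOrderZero

end

namespace EpsOrderZero

/-! The core is `‖φ 1 * φ x - φ x * φ 1‖ ≤ 4 * ε * ‖x‖` for `x ≥ 0`. Functional calculus reduces it
to `C(K, ℝ)` and `0 ≤ h ≤ 1`, where `n • h` is a sum of `n` ramps `R_i`. With `E_i = R_i - R_{i+1}`,
the commutator of `φ 1` and `φ R_{i+1}` is four products of orthogonal pairs (at most `4 * ε`) plus
the commutator of `φ E_i` and `φ E_{i+1}`. Sign averaging bounds the sum of the latter by `2 * ‖φ‖ ^
2`, whatever `n` is (`norm_sum_ramp_le`). Divide by `n` and let `n → ∞`. Polynomials follow by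
induction from `P(h) = h * τP(h) + P(0)` and the Leibniz rule. -/

/-- Averaging over signs bounds a diagonal sum of a bilinear map by its values on signed sums. -/
theorem norm_add_sum_mul_le {ι E B : Type*} [DecidableEq ι] [AddCommGroup E] [Module ℝ E]
    [NonUnitalNormedRing B] [NormedSpace ℝ B] (φ : E →ₗ[ℝ] B) (a b : ι → E) (C : ℝ)
    (S : Finset ι) (u v : E)
    (h : ∀ s : ι → ℝ, (∀ i, |s i| ≤ 1) →
      ‖φ (u + ∑ i ∈ S, s i • a i) * φ (v + ∑ i ∈ S, s i • b i)‖ ≤ C) :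
    ‖φ u * φ v + ∑ i ∈ S, φ (a i) * φ (b i)‖ ≤ C := by
  induction S using Finset.induction_on generalizing u v with
  | empty => simpa using h 0 (by simp)
  | insert j S hj ih =>
    have key : ∀ c : ℝ, |c| ≤ 1 →
        ‖φ (u + c • a j) * φ (v + c • b j) + ∑ i ∈ S, φ (a i) * φ (b i)‖ ≤ C := by
      intro c hc
      refine ih _ _ fun s hs => ?_
      have := h (Function.update s j c) (fun i => by
        rcases eq_or_ne i j with rfl | hij
        · simpa using hc
        · simpa [hij] using hs i)
      rw [Finset.sum_insert hj, Finset.sum_insert hj] at this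
      have e : ∀ w : ι → E, ∑ i ∈ S, Function.update s j c i • w i = ∑ i ∈ S, s i • w i :=
        fun w => Finset.sum_congr rfl fun i hi => by
          rw [Function.update_of_ne (ne_of_mem_of_not_mem hi hj)]
      simpa [e, add_assoc] using this
    have h1 := key 1 (by simp)
    have h2 := key (-1) (by simp)
    rw [Finset.sum_insert hj]
    set T := ∑ i ∈ S, φ (a i) * φ (b i)
    -- The cross terms are odd in the sign, so adding the cases `c = 1` and `c = -1` cancels them.
    have e : (φ u * φ v + (φ (a j) * φ (b j) + T)) + (φ u * φ v + (φ (a j) * φ (b j) + T))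
        = (φ (u + (1 : ℝ) • a j) * φ (v + (1 : ℝ) • b j) + T)
          + (φ (u + (-1 : ℝ) • a j) * φ (v + (-1 : ℝ) • b j) + T) := by
      simp only [one_smul, neg_smul, map_add, map_neg, mul_add, add_mul, neg_mul, mul_neg]
      abel
    have h3 := norm_add_le (φ (u + (1 : ℝ) • a j) * φ (v + (1 : ℝ) • b j) + T)
      (φ (u + (-1 : ℝ) • a j) * φ (v + (-1 : ℝ) • b j) + T)
    rw [← e, ← two_smul ℝ, norm_smul, Real.norm_ofNat] at h3
    linarith

/-- The truncation of a real number to the unit interval. -/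
def clamp (y : ℝ) : ℝ := max 0 (min 1 y)

theorem continuous_clamp : Continuous clamp := by
  unfold clamp; fun_prop

theorem clamp_nonneg (y : ℝ) : 0 ≤ clamp y := le_max_left _ _

theorem clamp_le_one (y : ℝ) : clamp y ≤ 1 := max_le zero_le_one (min_le_left _ _)

theorem clamp_of_nonpos {y : ℝ} (h : y ≤ 0) : clamp y = 0 :=
  max_eq_left ((min_le_right _ _).trans h)

theorem clamp_of_one_le {y : ℝ} (h : 1 ≤ y) : clamp y = 1 := by
  simp [clamp, min_eq_left h]

theorem clamp_mono {y z : ℝ} (h : y ≤ z) : clamp y ≤ clamp z :=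
  max_le_max le_rfl (min_le_min le_rfl h)

theorem sum_range_clamp (y : ℝ) (hy : 0 ≤ y) (m : ℕ) :
    ∑ i ∈ Finset.range m, clamp (y - i) = min y m := by
  induction m with
  | zero => simp [hy]
  | succ m ih =>
    rw [Finset.sum_range_succ, ih, clamp]
    push_cast
    grind

/-! ### Almost orthogonality preserving maps on `C(K, ℝ)`. -/

section Commutative

variable {K : Type*} [TopologicalSpace K]

/-- The step function `t ↦ clamp (n h(t) + 1 - i)`, equal to `1` where `n h ≥ i` and
to `0` where `n h ≤ i - 1`. -/
def ramp (h : C(K, ℝ)) (n i : ℕ) : C(K, ℝ) :=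
  ⟨fun t => clamp (n * h t + 1 - i), continuous_clamp.comp (by fun_prop)⟩

theorem ramp_apply (h : C(K, ℝ)) (n i : ℕ) (t : K) :
    ramp h n i t = clamp (n * h t + 1 - i) := rfl

theorem ramp_succ_le (h : C(K, ℝ)) (n i : ℕ) (t : K) : ramp h n (i + 1) t ≤ ramp h n i t :=
  clamp_mono (by push_cast; linarith)

theorem one_sub_ramp_mul_ramp_succ (h : C(K, ℝ)) (n i : ℕ) (t : K) :
    (1 - ramp h n i t) * ramp h n (i + 1) t = 0 := by
  rcases le_total (i : ℝ) (n * h t) with H | H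
  · rw [ramp_apply, clamp_of_one_le (by linarith)]; simp
  · rw [ramp_apply h n (i + 1), clamp_of_nonpos (by push_cast; linarith)]; simp

variable [CompactSpace K]

/-- The differences are nonnegative and telescope, so even their absolute sum stays below one. -/
theorem norm_sum_smul_ramp_sub_le (h : C(K, ℝ)) (n m k : ℕ) (s : ℕ → ℝ) (hs : ∀ i, |s i| ≤ 1) :
    ‖∑ i ∈ Finset.range m, s i • (ramp h n (i + k) - ramp h n (i + k + 1))‖ ≤ 1 := by
  rw [ContinuousMap.norm_le _ zero_le_one]
  intro t
  rw [ContinuousMap.sum_apply, Real.norm_eq_abs]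
  calc |∑ i ∈ Finset.range m, (s i • (ramp h n (i + k) - ramp h n (i + k + 1))) t|
      ≤ ∑ i ∈ Finset.range m, (ramp h n (i + k) t - ramp h n (i + 1 + k) t) := by
        refine (Finset.abs_sum_le_sum_abs _ _).trans (Finset.sum_le_sum fun i _ => ?_)
        have h0 : 0 ≤ ramp h n (i + k) t - ramp h n (i + k + 1) t :=
          sub_nonneg.2 (ramp_succ_le h n (i + k) t)
        rw [add_right_comm i 1 k]
        simp only [ContinuousMap.smul_apply, ContinuousMap.sub_apply, smul_eq_mul, abs_mul,
          abs_of_nonneg h0]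
        exact mul_le_of_le_one_left h0 (hs i)
    _ = ramp h n (0 + k) t - ramp h n (m + k) t :=
        Finset.sum_range_sub' (fun i => ramp h n (i + k) t) m
    _ ≤ 1 := by
        have := clamp_le_one (n * h t + 1 - (0 + k : ℕ))
        have := clamp_nonneg (n * h t + 1 - (m + k : ℕ))
        simp only [ramp_apply]
        linarith

variable {B : Type*} [NonUnitalNormedRing B] [NormedSpace ℝ B]

theorem norm_sum_ramp_le (φ : C(K, ℝ) →L[ℝ] B) (h : C(K, ℝ)) (n m k l : ℕ) :
    ‖∑ i ∈ Finset.range m, φ (ramp h n (i + k) - ramp h n (i + k + 1))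
      * φ (ramp h n (i + l) - ramp h n (i + l + 1))‖ ≤ ‖φ‖ * ‖φ‖ := by
  have := norm_add_sum_mul_le (φ : C(K, ℝ) →ₗ[ℝ] B)
    (fun i => ramp h n (i + k) - ramp h n (i + k + 1))
    (fun i => ramp h n (i + l) - ramp h n (i + l + 1)) (‖φ‖ * ‖φ‖) (Finset.range m) 0 0
    (fun s hs => by
      simp only [zero_add]
      refine (norm_mul_le _ _).trans (mul_le_mul ?_ ?_ (norm_nonneg _) φ.opNorm_nonneg)
      · exact φ.le_of_opNorm_le_of_le le_rfl (norm_sum_smul_ramp_sub_le h n m k s hs) |>.trans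
          (mul_one _).le
      · exact φ.le_of_opNorm_le_of_le le_rfl (norm_sum_smul_ramp_sub_le h n m l s hs) |>.trans
          (mul_one _).le)
  simpa using this

variable [IsScalarTower ℝ B B] [SMulCommClass ℝ B B]

/-- The error is independent of `n`, so it vanishes after division by `n`. -/
theorem norm_commutator_le_add (φ : C(K, ℝ) →L[ℝ] B) {ε : ℝ}
    (hφ : ∀ f g : C(K, ℝ), 0 ≤ f → 0 ≤ g → f * g = 0 → ‖f‖ ≤ 1 → ‖g‖ ≤ 1 → ‖φ f * φ g‖ ≤ ε)
    (h : C(K, ℝ)) (h0 : 0 ≤ h) (h1 : h ≤ 1) (n : ℕ) :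
    n * ‖φ 1 * φ h - φ h * φ 1‖ ≤ n * (4 * ε) + 2 * (‖φ‖ * ‖φ‖) := by
  have hbd : ∀ f : C(K, ℝ), (∀ t, 0 ≤ f t ∧ f t ≤ 1) → 0 ≤ f ∧ ‖f‖ ≤ 1 := fun f hf =>
    ⟨fun t => (hf t).1, (ContinuousMap.norm_le _ zero_le_one).2 fun t => by
      rw [Real.norm_eq_abs, abs_of_nonneg (hf t).1]; exact (hf t).2⟩
  have hr : ∀ i t, 0 ≤ ramp h n i t ∧ ramp h n i t ≤ 1 := fun i t =>
    ⟨clamp_nonneg _, clamp_le_one _⟩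
  have hD : ∀ i, 0 ≤ 1 - ramp h n i ∧ ‖1 - ramp h n i‖ ≤ 1 := fun i => hbd _ fun t => by
    have := hr i t
    simp only [ContinuousMap.sub_apply, ContinuousMap.one_apply]
    constructor <;> linarith
  have hR : ∀ i, 0 ≤ ramp h n i ∧ ‖ramp h n i‖ ≤ 1 := fun i => hbd _ (hr i)
  have hE : ∀ i, 0 ≤ ramp h n i - ramp h n (i + 1) ∧ ‖ramp h n i - ramp h n (i + 1)‖ ≤ 1 :=
    fun i => hbd _ fun t => by
      have := hr i t
      have := hr (i + 1) t
      have := ramp_succ_le h n i t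
      simp only [ContinuousMap.sub_apply]
      constructor <;> linarith
  have o1 : ∀ i, (1 - ramp h n i) * ramp h n (i + 1) = 0 := fun i => by
    ext t; exact one_sub_ramp_mul_ramp_succ h n i t
  have o2 : ∀ i, (1 - ramp h n i) * (ramp h n (i + 1) - ramp h n (i + 1 + 1)) = 0 := fun i => by
    ext t
    have e1 := one_sub_ramp_mul_ramp_succ h n i t
    have := hr (i + 1 + 1) t
    have := hr i t
    have := ramp_succ_le h n (i + 1) t
    have e2 : (1 - ramp h n i t) * ramp h n (i + 1 + 1) t = 0 := by
      rcases mul_eq_zero.1 e1 with H | H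
      · rw [H, zero_mul]
      · rw [show ramp h n (i + 1 + 1) t = 0 by linarith, mul_zero]
    simp only [ContinuousMap.mul_apply, ContinuousMap.sub_apply, ContinuousMap.one_apply,
      ContinuousMap.zero_apply, mul_sub, e1, e2, sub_zero]
  have hsum : (n : ℝ) • h = ∑ i ∈ Finset.range n, ramp h n (i + 1) := by
    ext t
    have a0 : 0 ≤ h t := h0 t
    have a1 : h t ≤ 1 := h1 t
    have := sum_range_clamp (n * h t) (by positivity) n
    rw [min_eq_left (mul_le_of_le_one_right n.cast_nonneg a1)] at this
    simp only [ContinuousMap.smul_apply, smul_eq_mul, ContinuousMap.sum_apply, ramp_apply]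
    refine this.symm.trans (Finset.sum_congr rfl fun i _ => ?_)
    congr 1
    push_cast
    ring
  -- Replace `1` by `1 - R_{i+1}`, which leaves the commutator unchanged, and split `R_{i+1} =
  -- R_{i+2} + E_{i+1}`. Against `E_{i+1}`, split further `1 - R_{i+1} = (1 - R_i) + E_i`.
  have hsplit : ∀ i, φ 1 * φ (ramp h n (i + 1)) - φ (ramp h n (i + 1)) * φ 1
      = (φ (1 - ramp h n (i + 1)) * φ (ramp h n (i + 1 + 1))
          + φ (1 - ramp h n i) * φ (ramp h n (i + 1) - ramp h n (i + 1 + 1))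
          - φ (ramp h n (i + 1 + 1)) * φ (1 - ramp h n (i + 1))
          - φ (ramp h n (i + 1) - ramp h n (i + 1 + 1)) * φ (1 - ramp h n i))
        + φ (ramp h n (i + 0) - ramp h n (i + 0 + 1))
          * φ (ramp h n (i + 1) - ramp h n (i + 1 + 1))
        - φ (ramp h n (i + 1) - ramp h n (i + 1 + 1))
          * φ (ramp h n (i + 0) - ramp h n (i + 0 + 1)) := by
    intro i
    simp only [map_sub, mul_sub, sub_mul, add_zero]
    abel
  have hlhs : (n : ℝ) • (φ 1 * φ h - φ h * φ 1)
      = ∑ i ∈ Finset.range n, (φ 1 * φ (ramp h n (i + 1)) - φ (ramp h n (i + 1)) * φ 1) := by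
    rw [smul_sub, ← mul_smul_comm, ← smul_mul_assoc, ← map_smul, hsum, map_sum, Finset.mul_sum,
      Finset.sum_mul, Finset.sum_sub_distrib]
  have hnorm : n * ‖φ 1 * φ h - φ h * φ 1‖ = ‖(n : ℝ) • (φ 1 * φ h - φ h * φ 1)‖ := by
    rw [norm_smul, Real.norm_natCast]
  rw [hnorm, hlhs, Finset.sum_congr rfl fun i _ => hsplit i, Finset.sum_sub_distrib,
    Finset.sum_add_distrib]
  refine (norm_sub_le _ _).trans ?_
  refine (add_le_add_left (norm_add_le _ _) _).trans ?_
  have b1 := norm_sum_ramp_le φ h n n 0 1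
  have b2 := norm_sum_ramp_le φ h n n 1 0
  have b3 : ‖∑ i ∈ Finset.range n, (φ (1 - ramp h n (i + 1)) * φ (ramp h n (i + 1 + 1))
          + φ (1 - ramp h n i) * φ (ramp h n (i + 1) - ramp h n (i + 1 + 1))
          - φ (ramp h n (i + 1 + 1)) * φ (1 - ramp h n (i + 1))
          - φ (ramp h n (i + 1) - ramp h n (i + 1 + 1)) * φ (1 - ramp h n i))‖
      ≤ n * (4 * ε) := by
    refine (norm_sum_le_of_le _ (f := _) (n := fun _ => 4 * ε) fun i _ => ?_).trans (by simp)
    have c1 := hφ _ _ (hD (i + 1)).1 (hR (i + 1 + 1)).1 (o1 (i + 1)) (hD (i + 1)).2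
      (hR (i + 1 + 1)).2
    have c2 := hφ _ _ (hD i).1 (hE (i + 1)).1 (o2 i) (hD i).2 (hE (i + 1)).2
    have c3 := hφ _ _ (hR (i + 1 + 1)).1 (hD (i + 1)).1 ((mul_comm _ _).trans (o1 (i + 1)))
      (hR (i + 1 + 1)).2 (hD (i + 1)).2
    have c4 := hφ _ _ (hE (i + 1)).1 (hD i).1 ((mul_comm _ _).trans (o2 i)) (hE (i + 1)).2
      (hD i).2
    refine (norm_sub_le _ _).trans ((add_le_add_left (norm_sub_le _ _) _).trans ((add_le_add_left
      (add_le_add_left (norm_add_le _ _) _) _).trans ?_))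
    linarith
  linarith

/-- A bounded linear map on `C(K, ℝ)` that almost preserves orthogonality almost commutes with
its value at `1`. -/
theorem norm_commutator_le (φ : C(K, ℝ) →L[ℝ] B) {ε : ℝ}
    (hφ : ∀ f g : C(K, ℝ), 0 ≤ f → 0 ≤ g → f * g = 0 → ‖f‖ ≤ 1 → ‖g‖ ≤ 1 → ‖φ f * φ g‖ ≤ ε)
    (h : C(K, ℝ)) (h0 : 0 ≤ h) (h1 : h ≤ 1) :
    ‖φ 1 * φ h - φ h * φ 1‖ ≤ 4 * ε := by
  refine le_of_forall_pos_lt_add fun δ hδ => ?_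
  obtain ⟨n, hn⟩ := exists_nat_gt (2 * (‖φ‖ * ‖φ‖) / δ)
  have hn0 : (0 : ℝ) < n := lt_of_le_of_lt (by positivity) hn
  rw [div_lt_iff₀ hδ] at hn
  have := norm_commutator_le_add φ hφ h h0 h1 n
  refine lt_of_mul_lt_mul_left (a := (n : ℝ)) ?_ hn0.le
  rw [mul_add]
  linarith

end Commutative

/-! ### Passage to C*-algebras and to polynomials in `φ 1`. -/

section Main

variable {A B : Type*} [CStarAlgebra A] [PartialOrder A] [StarOrderedRing A]
  [NonUnitalCStarAlgebra B]

theorem norm_commutator_one_le_of_norm_le_one (φ : A →L[ℂ] B) {ε : ℝ} (hφ : IsEpsOrderZero ε φ)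
    (x : A) (hx : 0 ≤ x) (hx1 : ‖x‖ ≤ 1) :
    ‖φ 1 * φ x - φ x * φ 1‖ ≤ 4 * ε := by
  have hsa : IsSelfAdjoint x := .of_nonneg hx
  let Ψ := cfcHom (R := ℝ) hsa
  have hiso : ∀ f, ‖Ψ f‖ = ‖f‖ := norm_cfcHom (𝕜 := ℝ) x
  -- `x` corresponds to the coordinate function on its spectrum, which plays the role of `h`.
  have hid : Ψ (.restrict (spectrum ℝ x) (.id ℝ)) = x := cfcHom_id hsa
  have hpos : ∀ f, 0 ≤ f → 0 ≤ Ψ f := fun f hf => (cfcHom_nonneg_iff hsa).2 hf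
  let L : C(spectrum ℝ x, ℝ) →L[ℝ] B := (φ.restrictScalars ℝ).comp
    (LinearMap.mkContinuous Ψ.toAlgHom.toLinearMap 1 fun f => by
      simpa using (hiso f).le)
  have hL : ∀ f, L f = φ (Ψ f) := fun f => rfl
  have := norm_commutator_le L (ε := ε) (fun f g hf hg hfg hf1 hg1 => by
      have hm : Ψ f * Ψ g = 0 := by rw [← map_mul, hfg, map_zero]
      have hm' : Ψ g * Ψ f = 0 := by rw [← map_mul, mul_comm, hfg, map_zero]
      have := hφ.2 (Ψ f) (Ψ g) (hpos f hf) (hpos g hg)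
        ⟨hm, hm', by rw [(IsSelfAdjoint.of_nonneg (hpos f hf)).star_eq, hm],
          by rw [(IsSelfAdjoint.of_nonneg (hpos g hg)).star_eq, hm]⟩
      rw [hiso, hiso] at this
      refine this.trans ?_
      rw [mul_assoc]
      exact mul_le_of_le_one_right hφ.1 (mul_le_one₀ hf1 (norm_nonneg _) hg1))
    (.restrict (spectrum ℝ x) (.id ℝ))
    (fun t => spectrum_nonneg_of_nonneg hx t.2)
    (fun t => (le_abs_self _).trans ((ContinuousMap.norm_coe_le_norm
      (ContinuousMap.restrict (spectrum ℝ x) (.id ℝ)) t).trans (by rwa [← hiso, hid])))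
  simpa only [hL, hid, map_one] using this

theorem norm_commutator_one_le (φ : A →L[ℂ] B) {ε : ℝ} (hφ : IsEpsOrderZero ε φ)
    (x : A) (hx : 0 ≤ x) : ‖φ 1 * φ x - φ x * φ 1‖ ≤ 4 * ε * ‖x‖ := by
  rcases eq_or_ne x 0 with rfl | h0
  · simp
  have hn : 0 < ‖x‖ := norm_pos_iff.2 h0
  have := norm_commutator_one_le_of_norm_le_one φ hφ ((‖x‖⁻¹ : ℝ) • x)
    (smul_nonneg (by positivity) hx) (by rw [norm_smul, norm_inv, norm_norm, inv_mul_cancel₀ hn.ne'])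
  have e : φ ((‖x‖⁻¹ : ℝ) • x) = (‖x‖⁻¹ : ℝ) • φ x := (φ.restrictScalars ℝ).map_smul _ _
  rw [e, mul_smul_comm, smul_mul_assoc, ← smul_sub, norm_smul, norm_inv, norm_norm,
    inv_mul_le_iff₀ hn] at this
  linarith

theorem norm_map_one_le_normPos (φ : A →L[ℂ] B) : ‖φ 1‖ ≤ normPos φ := by
  refine le_csSup ⟨‖φ‖, ?_⟩ ⟨1, zero_le_one, ?_, rfl⟩
  · rintro r ⟨x, -, hx, rfl⟩
    exact (φ.le_of_opNorm_le_of_le le_rfl hx).trans (mul_one _).le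
  · rcases subsingleton_or_nontrivial A with _ | _
    · rw [Subsingleton.elim (1 : A) 0, norm_zero]; exact zero_le_one
    · exact norm_one.le

theorem norm_coe_multiplier (b : B) : ‖(b : 𝓜(ℂ, B))‖ = ‖b‖ := by
  rw [← DoubleCentralizer.norm_fst, DoubleCentralizer.coe_fst,
    ContinuousLinearMap.opNorm_mul_apply]

/-- The constant is relaxed from `4` to `8` to match `theta`. -/
theorem norm_coe_commutator_one_le (φ : A →L[ℂ] B) {ε : ℝ} (hφ : IsEpsOrderZero ε φ)
    (x : A) (hx : 0 ≤ x) :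
    ‖(φ 1 : 𝓜(ℂ, B)) * (φ x : 𝓜(ℂ, B)) - (φ x : 𝓜(ℂ, B)) * (φ 1 : 𝓜(ℂ, B))‖
      ≤ 8 * ε * ‖x‖ := by
  have e : (φ 1 : 𝓜(ℂ, B)) * (φ x : 𝓜(ℂ, B)) - (φ x : 𝓜(ℂ, B)) * (φ 1 : 𝓜(ℂ, B))
      = ((φ 1 * φ x - φ x * φ 1 : B) : 𝓜(ℂ, B)) := by
    have := map_sub (DoubleCentralizer.coeHom (𝕜 := ℂ) (A := B)) (φ 1 * φ x) (φ x * φ 1)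
    rw [map_mul, map_mul] at this
    exact this.symm
  rw [e, norm_coe_multiplier]
  have := norm_commutator_one_le φ hφ x hx
  have := mul_nonneg hφ.1 (norm_nonneg x)
  linarith

theorem polyAt_eq_mul_add (P : ℂ[X]) (b : B) :
    polyAt P b = (b : 𝓜(ℂ, B)) * polyAt P.divX b + algebraMap ℂ _ (P.coeff 0) := by
  conv_lhs => rw [← P.divX_mul_X_add]
  rw [mul_comm]
  simp only [polyAt, map_add, map_mul, Polynomial.aeval_X, Polynomial.aeval_C]

theorem norm_polyAt_commutator_le (φ : A →L[ℂ] B) {ε : ℝ} (hφ : IsEpsOrderZero ε φ)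
    (x : A) (hx : 0 ≤ x) (N : ℕ) (P : ℂ[X]) (hP : P.natDegree = N + 1) :
    ‖polyAt P (φ 1) * (φ x : 𝓜(ℂ, B)) - (φ x : 𝓜(ℂ, B)) * polyAt P (φ 1)‖
      ≤ theta φ ε (N + 1) P * ‖x‖ := by
  have hc := norm_coe_commutator_one_le φ hφ x hx
  have hdeg := Polynomial.natDegree_divX_eq_natDegree_tsub_one (p := P)
  rw [hP, Nat.add_sub_cancel] at hdeg
  -- Leibniz rule for the commutator; the scalar `P(0)` is central and drops out.
  have hsplit : polyAt P (φ 1) * (φ x : 𝓜(ℂ, B)) - (φ x : 𝓜(ℂ, B)) * polyAt P (φ 1)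
      = (φ 1 : 𝓜(ℂ, B)) * (polyAt P.divX (φ 1) * (φ x : 𝓜(ℂ, B))
          - (φ x : 𝓜(ℂ, B)) * polyAt P.divX (φ 1))
        + ((φ 1 : 𝓜(ℂ, B)) * (φ x : 𝓜(ℂ, B)) - (φ x : 𝓜(ℂ, B)) * (φ 1 : 𝓜(ℂ, B)))
          * polyAt P.divX (φ 1) := by
    rw [polyAt_eq_mul_add P, add_mul, mul_add, Algebra.commutes (P.coeff 0) (φ x : 𝓜(ℂ, B))]
    noncomm_ring
  induction N generalizing P with
  | zero =>
    have hq : polyAt P.divX (φ 1) = algebraMap ℂ (𝓜(ℂ, B)) (P.coeff 1) := by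
      rw [Polynomial.eq_C_of_natDegree_eq_zero hdeg, polyAt, Polynomial.aeval_C,
        Polynomial.coeff_divX, zero_add]
    rw [hsplit, hq, Algebra.commutes (P.coeff 1) (φ x : 𝓜(ℂ, B)), sub_self, mul_zero, zero_add,
      ← Algebra.commutes, ← Algebra.smul_def, norm_smul, theta]
    have := mul_le_mul_of_nonneg_left hc (norm_nonneg (P.coeff 1))
    linarith
  | succ N ih =>
    have hd2 := Polynomial.natDegree_divX_eq_natDegree_tsub_one (p := P.divX)
    have h1 := ih P.divX hdeg (by rw [hd2, hdeg, Nat.add_sub_cancel]) (by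
      rw [polyAt_eq_mul_add P.divX, add_mul, mul_add,
        Algebra.commutes (P.divX.coeff 0) (φ x : 𝓜(ℂ, B))]
      noncomm_ring)
    have hn := norm_map_one_le_normPos φ
    have hn0 : 0 ≤ normPos φ := (norm_nonneg _).trans hn
    have h2 : 0 ≤ theta φ ε (N + 1) P.divX * ‖x‖ := (norm_nonneg _).trans h1
    rw [hsplit, theta]
    refine (norm_add_le _ _).trans ((add_le_add (norm_mul_le _ _) (norm_mul_le _ _)).trans ?_)
    rw [norm_coe_multiplier]
    have h3 := mul_le_mul hn h1 (norm_nonneg _) hn0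
    have h4 := mul_le_mul_of_nonneg_right hc (norm_nonneg (polyAt P.divX (φ 1)))
    -- Nonnegativity lets the coefficient `1` of `normPos φ` be raised to the `8` in `theta`.
    have h5 := mul_nonneg hn0 h2
    linarith

end Main

end EpsOrderZero

theorem proposition5p1 {A B : Type*} [CStarAlgebra A] [PartialOrder A] [StarOrderedRing A]
    [NonUnitalCStarAlgebra B] (φ : A →L[ℂ] B) (ε : ℝ) (hφ : EpsOrderZero.IsEpsOrderZero ε φ)
    (P : ℂ[X]) (N : ℕ) (hN : 0 < N) (hP : P.natDegree = N) (x : A) (hx : 0 ≤ x) :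
    ‖EpsOrderZero.polyAt P (φ 1) * (φ x : 𝓜(ℂ, B))
        - (φ x : 𝓜(ℂ, B)) * EpsOrderZero.polyAt P (φ 1)‖
      ≤ EpsOrderZero.theta φ ε N P * ‖x‖ := by
  obtain ⟨M, rfl⟩ := Nat.exists_eq_succ_of_ne_zero hN.ne'
  exact EpsOrderZero.norm_polyAt_commutator_le φ hφ x hx M P hP
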